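/- The L-surface is the closed region $([0,2]\times[0,1])\cup([0,1]\times[0,2])$, tiled by three unit squares, with opposite boundary edges identified by translation: $(x,0)\sim(x,2)$ for $0\le x\le 1$, $(x,0)\sim(x,1)$ for $1\le x\le 2$, $(0,y)\sim(2,y)$ for $0\le y\le 1$, and $(0,y)\sim(1,y)$ for $1\le y\le 2$. It carries the flat (path) metric. Its vertices are the images of the corners of the three squares. A half-infinite geodesic of slope $\alpha$ is a curve $\gamma(t)$, $t\ge 0$, on the L-surface, parametrized by arc length, that moves along straight lines in one constant direction of slope $\alpha$ and continues across identified edges; its starting point is arbitrary, and it is undefined after hitting a vertex at a time $t>0$. Theorem 6.1.1. Let $\alpha>1$ be badly approximable (that is, irrational with bounded continued fraction digits), with continued fraction $$\alpha=a_0+\cfrac{1}{a_1+\cfrac{1}{a_2+\cfrac{1}{a_3+\cdots}}},$$ where the digits $a_0,a_1,a_2,\ldots$ are all positive and even. Then every half-infinite geodesic of slope $\alpha$ on the L-surface which does not hit a vertex at a time $t>0$ is superdense: there is a constant $C=C(\alpha)>0$, depending only on $\alpha$, such that for every such geodesic, every integer $n\ge 1$ and every point $P$ of the L-surface, the initial segment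 of length $Cn$ of the geodesic contains a point at distance less than $1/n$ from $P$. -/

import Mathlib

open scoped ENNReal

noncomputable section

/-- The net of the L-surface: the closed L-shaped region tiled by the three unit squares
`[0,1] × [0,1]`, `[1,2] × [0,1]` and `[0,1] × [1,2]` of the Euclidean plane. -/
def LShape : Set (EuclideanSpace ℝ (Fin 2)) :=
  {p | (p 0 ∈ Set.Icc 0 2 ∧ p 1 ∈ Set.Icc 0 1) ∨ (p 0 ∈ Set.Icc 0 1 ∧ p 1 ∈ Set.Icc 0 2)}

/-- The identification of opposite boundary edges of the L-shape by perpendicular translation. -/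
inductive LGlue : LShape → LShape → Prop
  /-- `[0,1] × {0}` is glued to `[0,1] × {2}`. -/
  | h₁ (p q : LShape) : p.1 0 ∈ Set.Icc 0 1 → q.1 0 = p.1 0 → p.1 1 = 0 → q.1 1 = 2 → LGlue p q
  /-- `[1,2] × {0}` is glued to `[1,2] × {1}`. -/
  | h₂ (p q : LShape) : p.1 0 ∈ Set.Icc 1 2 → q.1 0 = p.1 0 → p.1 1 = 0 → q.1 1 = 1 → LGlue p q
  /-- `{0} × [0,1]` is glued to `{2} × [0,1]`. -/
  | v₁ (p q : LShape) : p.1 1 ∈ Set.Icc 0 1 → q.1 1 = p.1 1 → p.1 0 = 0 → q.1 0 = 2 → LGlue p q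
  /-- `{0} × [1,2]` is glued to `{1} × [1,2]`. -/
  | v₂ (p q : LShape) : p.1 1 ∈ Set.Icc 1 2 → q.1 1 = p.1 1 → p.1 0 = 0 → q.1 0 = 1 → LGlue p q

/-- The L-surface: the quotient of the L-shape by the equivalence relation generated by the
edge identifications. -/
def LSurface : Type := Quot LGlue

/-- The point of the L-surface represented by a point of the net. -/
def LSurface.mk (p : LShape) : LSurface := Quot.mk LGlue p

/-- A point of the L-surface is a vertex if it is represented by a corner of one of the three unit
squares, i.e. by a point of the net with integer coordinates. -/
def LSurface.IsVertex (x : LSurface) : Prop :=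
  ∃ (p : LShape) (i j : ℤ), p.1 0 = i ∧ p.1 1 = j ∧ x = LSurface.mk p

/-- `LSurface.IsPath x y ℓ`: there is a polygonal path on the L-surface from `x` to `y` of length
`ℓ`. Such a path is a finite succession of straight line segments of the net, where the
end point of each segment represents the same point of the surface as the starting point of the
next one. -/
inductive LSurface.IsPath (x : LSurface) : LSurface → ℝ → Prop
  | nil : LSurface.IsPath x x 0
  | step {ℓ : ℝ} (p q : LShape) : LSurface.IsPath x (LSurface.mk p) ℓ →
      segment ℝ p.1 q.1 ⊆ LShape → LSurface.IsPath x (LSurface.mk q) (ℓ + dist p.1 q.1)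

/-- The flat distance on the L-surface: the infimum of the lengths of the polygonal paths
joining two points. -/
def LSurface.flatEDist (x y : LSurface) : ℝ≥0∞ :=
  ⨅ (ℓ : ℝ) (_ : LSurface.IsPath x y ℓ), ENNReal.ofReal ℓ

/-- `γ`, restricted to times `t ≥ 0`, is a half-infinite geodesic on the L-surface with (constant)
velocity `v`. At every time it leaves, and at every positive time it also arrives, along a straight
line segment of the net traversed with velocity `v`; at positive times it does not hit a
vertex (where it would become undefined). The starting point may be any point, even a vertex.
Only the values `γ t` with `t ≥ 0` matter. -/
structure LSurface.IsHalfGeodesic (v : EuclideanSpace ℝ (Fin 2)) (γ : ℝ → LSurface) : Prop where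
  leaves : ∀ t : ℝ, 0 ≤ t → ∃ (p : EuclideanSpace ℝ (Fin 2)) (ε : ℝ), 0 < ε ∧
    ∀ u ∈ Set.Icc 0 ε, ∃ h : p + u • v ∈ LShape, γ (t + u) = LSurface.mk ⟨p + u • v, h⟩
  arrives : ∀ t : ℝ, 0 < t → ∃ (p : EuclideanSpace ℝ (Fin 2)) (ε : ℝ), 0 < ε ∧
    ∀ u ∈ Set.Icc 0 ε, ∃ h : p - u • v ∈ LShape, γ (t - u) = LSurface.mk ⟨p - u • v, h⟩
  avoids_vertices : ∀ t : ℝ, 0 < t → ¬ (γ t).IsVertex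

/-- The half-infinite curve `γ`, parametrized by arc length on `t ≥ 0`, is superdense with
constant `C`: for every integer `n ≥ 1` and every point `P` of the surface, the initial segment of
length `C n` gets `(1 / n)`-close to `P`. -/
def LSurface.IsSuperdenseWith (C : ℝ) (γ : ℝ → LSurface) : Prop :=
  ∀ n : ℕ, 1 ≤ n → ∀ P : LSurface, ∃ t ∈ Set.Icc (0 : ℝ) (C * n),
    LSurface.flatEDist (γ t) P < ENNReal.ofReal (1 / n)

/-- `α` has the infinite continued fraction expansion `[a 0; a 1, a 2, …]`. -/
def HasContFracDigits (α : ℝ) (a : ℕ → ℕ) : Prop :=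
  (GenContFract.of α).h = (a 0 : ℝ) ∧
    ∀ i : ℕ, (GenContFract.of α).partDens.get? i = some (a (i + 1) : ℝ)

/-- An irrational number is badly approximable if its continued fraction digits are bounded. -/
def IsBadlyApproximable (α : ℝ) : Prop :=
  Irrational α ∧
    ∃ C : ℝ, ∀ (i : ℕ) (b : ℝ), (GenContFract.of α).partDens.get? i = some b → b ≤ C

end

/-!
In local coordinates the lower edges of the three squares form three copies of `[0, 1)`, and flowing
once through the squares rotates the position by `θ = α⁻¹` and moves the label by the transposition
`up`, preceded by the transposition `right` if the position wraps around. For a skew product of this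
kind over the rotation by `θ`, consider the first return to the positions in `(0, θ)`, rescaled to
`(0, 1)` and reflected. It is a skew product over the rotation by the Gauss image `θ⁻¹ - a` of `θ`.
As the digit `a` is even, the `a` or `a + 1` transpositions `v` performed between two returns
cancel up to parity, and what remains is the same kind of labelling with the two transpositions
exchanged. Every renormalization thus improves the approximation of a given position and label by
the factor `θ` at the cost of a factor `θ⁻¹` in time. Since the digits are bounded, so are the
inverses of all Gauss iterates, and `k` renormalizations, with `k` the first index at which the
product of the Gauss iterates drops to `1 / n`, reduce superdensity to the fact that
within bounded time every orbit visits all labels on both sides of the wrapping point.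
-/

noncomputable section

open Set Metric Function

lemma forall_mem_Icc_of_left_of_right {β : Type*} [ConditionallyCompleteLinearOrder β]
    {P : β → Prop} {a b : β} (left : ∀ x ∈ Icc a b, (∀ y ∈ Ico a x, P y) → P x)
    (right : ∀ x ∈ Ico a b, P x → ∃ c > x, ∀ y ∈ Ioo x c, P y) : ∀ x ∈ Icc a b, P x := by
  by_contra! ⟨x, hx, hPx⟩
  let S := {y | y ∈ Icc a b ∧ ¬ P y}
  have bddBelow : BddBelow S := ⟨a, fun y hy => hy.1.1⟩
  have sInf_le : sInf S ≤ x := csInf_le bddBelow ⟨hx, hPx⟩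
  have le_sInf : a ≤ sInf S := le_csInf ⟨x, hx, hPx⟩ fun y hy => hy.1.1
  have at_sInf : P (sInf S) := left _ ⟨le_sInf, sInf_le.trans hx.2⟩ fun y hy => by
    by_contra hPy
    exact hy.2.not_ge (csInf_le bddBelow ⟨⟨hy.1, hy.2.le.trans (sInf_le.trans hx.2)⟩, hPy⟩)
  have sInf_lt : sInf S < x := sInf_le.lt_of_ne fun h => hPx (h ▸ at_sInf)
  obtain ⟨c, hc, hPc⟩ := right _ ⟨le_sInf, sInf_lt.trans_le hx.2⟩ at_sInf
  obtain ⟨y, hy, hyc⟩ := exists_lt_of_csInf_lt (s := S) ⟨x, hx, hPx⟩ hc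
  exact hy.2 (hPc y ⟨(csInf_le bddBelow hy).lt_of_ne fun h => hy.2 (h ▸ at_sInf), hyc⟩)

lemma exists_seq_of_forall_exists_succ {β : Type*} {P : ℕ → β → Prop} {R : β → β → Prop}
    (h₀ : ∃ b, P 0 b) (hs : ∀ n b, P n b → ∃ c, P (n + 1) c ∧ R b c) :
    ∃ s : ℕ → β, ∀ n, P n (s n) ∧ R (s n) (s (n + 1)) := by
  obtain ⟨b, hb⟩ := h₀
  choose! next hnext using hs
  let s : ℕ → β := Nat.rec b next
  have hP : ∀ n, P n (s n) := Nat.rec hb fun n ih => (hnext n _ ih).1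
  exact ⟨s, fun n => ⟨hP n, (hnext n _ (hP n)).2⟩⟩

/-- One step of the skew product over the rotation of the circle `[0, 1)` by `θ`: the label changes
by `v`, preceded by `h` if the position wraps around. -/
def SkewStep {X : Type*} (θ : ℝ) (h v : X → X) (p q : ℝ × X) : Prop :=
  q = (p.1 + θ, v p.2) ∨ q = (p.1 + θ - 1, v (h p.2))

/-- An orbit of the skew product over the rotation by `θ` whose position never meets the
discontinuity `0 = 1`. -/
structure IsSkewOrbit {X : Type*} (θ : ℝ) (h v : X → X) (o : ℕ → ℝ × X) : Prop where
  mem_Ioo : ∀ m, (o m).1 ∈ Ioo (0 : ℝ) 1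
  step : ∀ m, SkewStep θ h v (o m) (o (m + 1))

/-- `θ' = θ⁻¹ - a` is the image of `θ` under the Gauss map, with even digit `a`. -/
structure IsEvenGaussStep (a : ℕ) (θ θ' : ℝ) : Prop where
  even : Even a
  two_le : 2 ≤ a
  mem_Ioo : θ' ∈ Ioo (0 : ℝ) 1
  add_mul_eq_one : (a + θ') * θ = 1

namespace IsEvenGaussStep

variable {a : ℕ} {θ θ' : ℝ}

lemma pos (G : IsEvenGaussStep a θ θ') : 0 < θ :=
  pos_of_mul_pos_right (G.add_mul_eq_one ▸ one_pos)
    (by linarith [G.mem_Ioo.1, a.cast_nonneg (α := ℝ)])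

lemma le_half (G : IsEvenGaussStep a θ θ') : θ ≤ 1 / 2 := by
  have two_le : (2 : ℝ) ≤ a := by exact_mod_cast G.two_le
  nlinarith [G.add_mul_eq_one, G.pos, G.mem_Ioo.1]

lemma exists_eq_succ (G : IsEvenGaussStep a θ θ') : ∃ b, a = b + 1 ∧ Odd b := by
  obtain ⟨b, rfl⟩ := Nat.exists_eq_succ_of_ne_zero (by have := G.two_le; omega : a ≠ 0)
  exact ⟨b, rfl, Nat.not_even_iff_odd.1 (Nat.even_add_one.1 G.even)⟩

end IsEvenGaussStep

/-- The change of coordinates under which the first return of an orbit to the positions in `(0, θ)`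
becomes an orbit for the image of `θ` under the Gauss map. -/
def renorm {X : Type*} (θ : ℝ) (v : X → X) (p : ℝ × X) : ℝ × X :=
  (1 - p.1 / θ, v p.2)

namespace IsSkewOrbit

variable {X : Type*} {θ θ' : ℝ} {h v : X → X} {o : ℕ → ℝ × X} {a m j : ℕ}

lemma succ_of_le (H : IsSkewOrbit θ h v o) (hm : (o m).1 + θ ≤ 1) :
    o (m + 1) = ((o m).1 + θ, v (o m).2) := by
  refine (H.step m).resolve_right fun hw => ?_
  have := (H.mem_Ioo (m + 1)).1
  rw [hw] at this
  linarith

lemma succ_of_lt (H : IsSkewOrbit θ h v o) (hm : 1 < (o m).1 + θ) :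
    o (m + 1) = ((o m).1 + θ - 1, v (h (o m).2)) := by
  refine (H.step m).resolve_left fun hw => ?_
  have := (H.mem_Ioo (m + 1)).2
  rw [hw] at this
  linarith

lemma add_of_le (H : IsSkewOrbit θ h v o) (hθ : 0 < θ) (hj : (o m).1 + j * θ ≤ 1) :
    o (m + j) = ((o m).1 + j * θ, v^[j] (o m).2) := by
  induction j with
  | zero => simp
  | succ j ih =>
    push_cast at hj
    have hmj := ih (by linarith)
    rw [← add_assoc, H.succ_of_le (by rw [hmj]; linarith), hmj, iterate_succ_apply']
    push_cast
    congr 1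
    ring

lemma add_succ_of_wrap (H : IsSkewOrbit θ h v o) (hθ : 0 < θ) (hj : (o m).1 + j * θ ≤ 1)
    (hj' : 1 < (o m).1 + (j + 1) * θ) :
    o (m + (j + 1)) = ((o m).1 + (j + 1) * θ - 1, v (h (v^[j] (o m).2))) ∧
      (o (m + (j + 1))).1 < θ := by
  have hmj := H.add_of_le hθ hj
  have hlt := (H.mem_Ioo (m + j)).2
  have hwrap := H.succ_of_lt (m := m + j) (by rw [hmj]; linarith)
  rw [hmj] at hlt hwrap
  rw [← add_assoc, hwrap]
  refine ⟨?_, by linarith⟩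
  congr 1
  ring

lemma exists_wrap (H : IsSkewOrbit θ h v o) (hθ : 0 < θ) (m : ℕ) :
    ∃ j : ℕ, (o m).1 + j * θ ≤ 1 ∧ 1 < (o m).1 + (j + 1) * θ := by
  have hx := (H.mem_Ioo m).2
  refine ⟨⌊(1 - (o m).1) / θ⌋₊, ?_, ?_⟩
  · have := Nat.floor_le (div_nonneg (sub_nonneg.2 hx.le) hθ.le)
    rw [le_div_iff₀ hθ] at this
    linarith
  · have := Nat.lt_floor_add_one ((1 - (o m).1) / θ)
    rw [div_lt_iff₀ hθ] at this
    linarith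

lemma exists_return (H : IsSkewOrbit θ h v o) (G : IsEvenGaussStep a θ θ') (hv : Involutive v)
    (hm : (o m).1 < θ) :
    ∃ k : ℕ, (o k).1 < θ ∧ (o k).1 = (o m).1 + (k - m) * θ - 1 ∧
      SkewStep θ' v h (renorm θ v (o m)) (renorm θ v (o k)) := by
  have hθ := G.pos
  have hx := (H.mem_Ioo m).1
  obtain ⟨hθ'₀, hθ'₁⟩ := G.mem_Ioo
  have hG := G.add_mul_eq_one
  rcases lt_or_ge (θ' * θ) (o m).1 with hc | hc
  · obtain ⟨b, rfl, hb⟩ := G.exists_eq_succ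
    push_cast at hG
    obtain ⟨hk, hlt⟩ := H.add_succ_of_wrap hθ (m := m) (j := b) (by nlinarith) (by linarith)
    refine ⟨m + (b + 1), hlt, by rw [hk]; push_cast; ring, Or.inl ?_⟩
    simp only [renorm, hk, hv.iterate_odd hb, hv _]
    congr 1
    field_simp
    linarith
  · obtain ⟨hk, hlt⟩ := H.add_succ_of_wrap hθ (m := m) (j := a) (by linarith) (by nlinarith)
    refine ⟨m + (a + 1), hlt, by rw [hk]; push_cast; ring, Or.inr ?_⟩
    simp only [renorm, hk, hv.iterate_even G.even, hv _, id]
    congr 1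
    field_simp
    linarith

/-- The roles of `h` and `v` are exchanged because the even digit makes `v` act trivially during
each passage through `[0, 1)`, up to the normalization of the label in `renorm`. -/
lemma exists_renormalized (H : IsSkewOrbit θ h v o) (G : IsEvenGaussStep a θ θ')
    (hv : Involutive v) :
    ∃ r : ℕ → ℝ × X, IsSkewOrbit θ' v h r ∧ ∀ i j : ℕ, θ * (1 - (r i).1 + j) ≤ 1 →
      ∃ m : ℕ, (m : ℝ) ≤ (i + 2) / θ ∧ o m = (θ * (1 - (r i).1 + j), v^[j + 1] (r i).2) := by
  have hθ := G.pos
  obtain ⟨k, hk⟩ := exists_seq_of_forall_exists_succ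
    (P := fun i k => (o k).1 < θ ∧ (o k).1 = (o 0).1 + k * θ - (i + 1))
    (R := fun m k => SkewStep θ' v h (renorm θ v (o m)) (renorm θ v (o k)))
    (by
      obtain ⟨j, hj, hj'⟩ := H.exists_wrap hθ 0
      obtain ⟨heq, hlt⟩ := H.add_succ_of_wrap hθ hj hj'
      exact ⟨0 + (j + 1), hlt, by rw [heq]; push_cast; ring⟩)
    (fun i m ⟨hlt, heq⟩ => by
      obtain ⟨k, hklt, hkeq, hstep⟩ := H.exists_return G hv hlt
      exact ⟨k, ⟨hklt, by rw [hkeq, heq]; push_cast; ring⟩, hstep⟩)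
  refine ⟨fun i => renorm θ v (o (k i)), ⟨fun i => ?_, fun i => (hk i).2⟩, fun i j hij => ?_⟩
  · have hlt := (div_lt_one hθ).2 (hk i).1.1
    have hpos := div_pos (H.mem_Ioo (k i)).1 hθ
    constructor <;> simp only [renorm] <;> linarith
  · have hpos : θ * (1 - (renorm θ v (o (k i))).1 + j) = (o (k i)).1 + j * θ := by
      simp only [renorm]
      field_simp
      ring
    rw [hpos] at hij ⊢
    refine ⟨k i + j, ?_, ?_⟩
    · rw [le_div_iff₀ hθ]
      push_cast
      linarith [(hk i).1.2, (H.mem_Ioo 0).1]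
    · rw [H.add_of_le hθ hij, iterate_succ_apply]
      simp only [renorm, hv _]

end IsSkewOrbit

/-- Every orbit of the skew product visits every label at a position in `I` within time `N`. -/
def HitsWithin {X : Type*} (θ : ℝ) (h v : X → X) (I : Set ℝ) (N : ℝ) : Prop :=
  ∀ o, IsSkewOrbit θ h v o → ∀ g, ∃ m : ℕ, (m : ℝ) ≤ N ∧ (o m).2 = g ∧ (o m).1 ∈ I

namespace HitsWithin

variable {X : Type*} {θ θ' : ℝ} {h v : X → X} {a : ℕ} {I J : Set ℝ} {N N' : ℝ}

lemma mono (H : HitsWithin θ h v I N) (hIJ : I ∩ Ioo 0 1 ⊆ J) (hN : N ≤ N') :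
    HitsWithin θ h v J N' := by
  intro o ho g
  obtain ⟨m, hm, hg, hI⟩ := H o ho g
  exact ⟨m, hm.trans hN, hg, hIJ ⟨hI, ho.mem_Ioo m⟩⟩

lemma of_renormalized (H : HitsWithin θ' v h I N) (G : IsEvenGaussStep a θ θ')
    (hv : Involutive v) (j : ℕ)
    (hIJ : ∀ z ∈ I, z ∈ Ioo 0 1 → θ * (1 - z + j) ≤ 1 ∧ θ * (1 - z + j) ∈ J) :
    HitsWithin θ h v J ((N + 2) / θ) := by
  intro o ho g
  obtain ⟨r, hr, hro⟩ := ho.exists_renormalized G hv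
  obtain ⟨g', rfl⟩ := hv.surjective.iterate (j + 1) g
  obtain ⟨i, hi, rfl, hI⟩ := H r hr g'
  obtain ⟨hle, hJ⟩ := hIJ _ hI (hr.mem_Ioo i)
  obtain ⟨m, hm, hom⟩ := hro i j hle
  have hθ := G.pos
  exact ⟨m, hm.trans (by gcongr), by rw [hom], by rwa [hom]⟩

end HitsWithin

/-- `h` and `v` are two different transpositions of a set of three labels. -/
def IsTranspositionPair {X : Type*} (h v : X → X) : Prop :=
  ∃ A B C : X, (∀ g, g = A ∨ g = B ∨ g = C) ∧
    h A = B ∧ h B = A ∧ h C = C ∧ v A = C ∧ v C = A ∧ v B = B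

namespace IsTranspositionPair

variable {X : Type*} {h v : X → X}

lemma symm (T : IsTranspositionPair h v) : IsTranspositionPair v h := by
  obtain ⟨A, B, C, hABC, hA, hB, hC, vA, vC, vB⟩ := T
  exact ⟨A, C, B, fun g => (hABC g).imp_right Or.symm, vA, vC, vB, hA, hB, hC⟩

lemma involutive_left (T : IsTranspositionPair h v) : Involutive h := by
  obtain ⟨A, B, C, hABC, hA, hB, hC, -⟩ := T
  intro g
  rcases hABC g with rfl | rfl | rfl <;> simp only [hA, hB, hC]

lemma involutive_right (T : IsTranspositionPair h v) : Involutive v :=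
  T.symm.involutive_left

end IsTranspositionPair

section VisitsOfLabels

variable {X : Type*} {θ θ' : ℝ} {h v : X → X} {o : ℕ → ℝ × X} {a m : ℕ} {N : ℝ}

lemma IsSkewOrbit.exists_label_eq_of_fixed (H : IsSkewOrbit θ h v o) (hθ : 0 < θ)
    (hm : v (o m).2 = (o m).2) :
    ∃ i : ℕ, (i : ℝ) ≤ m + 1 / θ + 1 ∧ (o i).2 = v (h (o m).2) := by
  obtain ⟨j, hj, hj'⟩ := H.exists_wrap hθ m
  have hjθ : (j : ℝ) ≤ 1 / θ := by
    rw [le_div_iff₀ hθ]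
    linarith [(H.mem_Ioo m).1]
  refine ⟨m + (j + 1), by push_cast; linarith, ?_⟩
  rw [(H.add_succ_of_wrap hθ hj hj').1, iterate_fixed hm]

lemma IsSkewOrbit.exists_label_eq_or_eq_apply (H : IsSkewOrbit θ h v o) (hθ : 0 < θ)
    (T : IsTranspositionPair h v) (g : X) :
    ∃ i : ℕ, (i : ℝ) ≤ 1 / θ + 3 ∧ ((o i).2 = g ∨ (o i).2 = h g) := by
  obtain ⟨A, B, C, hABC, hA, hB, hC, vA, vC, vB⟩ := T
  have hinv : 0 < 1 / θ := by positivity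
  have label_one : (o 1).2 = v (o 0).2 ∨ (o 1).2 = v (h (o 0).2) :=
    (H.step 0).imp (congrArg Prod.snd) (congrArg Prod.snd)
  have reaches_C_of_B : ∀ m : ℕ, m ≤ 1 → (o m).2 = B →
      ∃ i : ℕ, (i : ℝ) ≤ 1 / θ + 3 ∧ (o i).2 = C := fun m hm hB' => by
    obtain ⟨i, hi, hi'⟩ := H.exists_label_eq_of_fixed hθ (m := m) (by rw [hB', vB])
    have : (m : ℝ) ≤ 1 := by exact_mod_cast hm
    exact ⟨i, by linarith, by rw [hi', hB', hB, vA]⟩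
  have reaches_C : ∃ i : ℕ, (i : ℝ) ≤ 1 / θ + 3 ∧ (o i).2 = C := by
    rcases hABC (o 0).2 with h₀ | h₀ | h₀
    · rw [h₀, hA, vA, vB] at label_one
      exact label_one.elim (fun h₁ => ⟨1, by push_cast; linarith, h₁⟩) (reaches_C_of_B 1 le_rfl)
    · exact reaches_C_of_B 0 zero_le_one h₀
    · exact ⟨0, by push_cast; linarith, h₀⟩
  have reaches_A_or_B : ∃ i : ℕ, (i : ℝ) ≤ 1 / θ + 3 ∧ ((o i).2 = A ∨ (o i).2 = B) := by
    rcases hABC (o 0).2 with h₀ | h₀ | h₀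
    · exact ⟨0, by push_cast; linarith, Or.inl h₀⟩
    · exact ⟨0, by push_cast; linarith, Or.inr h₀⟩
    · rw [h₀, hC, vC, or_self] at label_one
      exact ⟨1, by push_cast; linarith, Or.inl label_one⟩
  rcases hABC g with rfl | rfl | rfl
  · rwa [hA]
  · simpa only [hB, or_comm] using reaches_A_or_B
  · simpa only [hC, or_self] using reaches_C

lemma hitsWithin_univ (G : IsEvenGaussStep a θ θ') (T : IsTranspositionPair h v) :
    HitsWithin θ h v univ ((1 / θ' + 5) / θ) := by
  intro o ho g
  have hθ := G.pos
  have hv := T.involutive_right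
  obtain ⟨r, hr, hro⟩ := ho.exists_renormalized G hv
  obtain ⟨i, hi, hg⟩ := hr.exists_label_eq_or_eq_apply G.mem_Ioo.1 T.symm g
  suffices ∃ j : ℕ, j ≤ 1 ∧ v^[j + 1] (r i).2 = g by
    obtain ⟨j, hj, hjg⟩ := this
    have hj₁ : (j : ℝ) ≤ 1 := by exact_mod_cast hj
    obtain ⟨m, hm, hom⟩ := hro i j (by nlinarith [G.le_half, (hr.mem_Ioo i).1])
    exact ⟨m, hm.trans (by gcongr ?_ / _; linarith), by rw [hom, hjg], mem_univ _⟩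
  rcases hg with hg | hg
  · exact ⟨1, le_rfl, by rw [hg]; exact hv g⟩
  · exact ⟨0, zero_le_one, by rw [hg]; exact hv g⟩

lemma HitsWithin.Iic_of_renormalized (H : HitsWithin θ' v h univ N) (G : IsEvenGaussStep a θ θ')
    (hv : Involutive v) : HitsWithin θ h v (Iic (1 - θ)) ((N + 2) / θ) := by
  refine H.of_renormalized G hv 0 fun z _ ⟨hz, _⟩ => ?_
  have := G.pos
  have := G.le_half
  simp only [Nat.cast_zero, add_zero, mem_Iic]
  constructor <;> nlinarith

lemma HitsWithin.Ici_of_renormalized (H : HitsWithin θ' v h (Iic (1 - θ')) N)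
    (G : IsEvenGaussStep a θ θ') (hv : Involutive v) :
    HitsWithin θ h v (Ici (1 - θ)) ((N + 2) / θ) := by
  have hθ := G.pos
  have hθ' := G.mem_Ioo.1
  obtain ⟨b, rfl, -⟩ := G.exists_eq_succ
  have hG := G.add_mul_eq_one
  push_cast at hG
  refine H.of_renormalized G hv b fun z hz ⟨hz₀, _⟩ => ?_
  rw [mem_Iic] at hz
  rw [mem_Ici]
  constructor <;> nlinarith

end VisitsOfLabels

/-- Every orbit approaches, within time `N`, every position with every label up to distance `ε`.
The position `y` is approached from its own side of the point `1 - θ` beyond which the rotation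
wraps around. -/
structure Recurs {X : Type*} (θ : ℝ) (h v : X → X) (ε N : ℝ) : Prop where
  low : ∀ y ∈ Icc 0 (1 - θ), HitsWithin θ h v (closedBall y ε ∩ Iic (1 - θ)) N
  high : ∀ y ∈ Icc (1 - θ) 1, HitsWithin θ h v (closedBall y ε ∩ Ici (1 - θ)) N

namespace Recurs

variable {X : Type*} {θ θ' ε ε' N N' : ℝ} {h v : X → X} {a : ℕ}

lemma mono (H : Recurs θ h v ε N) (hε : ε ≤ ε') (hN : N ≤ N') : Recurs θ h v ε' N' where
  low y hy := (H.low y hy).mono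
    (inter_subset_left.trans (inter_subset_inter_left _ (closedBall_subset_closedBall hε))) hN
  high y hy := (H.high y hy).mono
    (inter_subset_left.trans (inter_subset_inter_left _ (closedBall_subset_closedBall hε))) hN

lemma of_hitsWithin (h₀ : 0 ≤ θ) (h₁ : θ ≤ 1) (hlow : HitsWithin θ h v (Iic (1 - θ)) N)
    (hhigh : HitsWithin θ h v (Ici (1 - θ)) N) : Recurs θ h v 1 N where
  low _ hy := hlow.mono (fun _ ⟨hle, hx⟩ => ⟨Real.dist_le_of_mem_Icc_01 (Ioo_subset_Icc_self hx)
    ⟨hy.1, hy.2.trans (sub_le_self 1 h₀)⟩, hle⟩) le_rfl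
  high _ hy := hhigh.mono (fun _ ⟨hle, hx⟩ => ⟨Real.dist_le_of_mem_Icc_01 (Ioo_subset_Icc_self hx)
    ⟨(sub_nonneg.2 h₁).trans hy.1, hy.2⟩, hle⟩) le_rfl

lemma hitsWithin_closedBall (H : Recurs θ h v ε N) {y : ℝ} (hy : y ∈ Icc (0 : ℝ) 1) :
    HitsWithin θ h v (closedBall y ε) N := by
  rcases le_total y (1 - θ) with hle | hle
  · exact (H.low y ⟨hy.1, hle⟩).mono (inter_subset_left.trans inter_subset_left) le_rfl
  · exact (H.high y ⟨hle, hy.2⟩).mono (inter_subset_left.trans inter_subset_left) le_rfl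

lemma mem_closedBall_of_renormalized {y z j : ℝ} (hθ : 0 < θ)
    (hz : z ∈ closedBall (1 - (y / θ - j)) ε) : θ * (1 - z + j) ∈ closedBall y (θ * ε) := by
  rw [mem_closedBall, Real.dist_eq] at hz ⊢
  have hsub : θ * (1 - z + j) - y = -(θ * (z - (1 - (y / θ - j)))) := by
    field_simp
    ring
  rw [hsub, abs_neg, abs_mul, abs_of_pos hθ]
  gcongr

lemma low_of_renormalized (H : Recurs θ' v h ε N) (G : IsEvenGaussStep a θ θ')
    (hv : Involutive v) {y : ℝ} (hy : y ∈ Icc 0 (1 - θ)) :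
    HitsWithin θ h v (closedBall y (θ * ε) ∩ Iic (1 - θ)) ((N + 2) / θ) := by
  have hθ := G.pos
  have hG := G.add_mul_eq_one
  obtain ⟨hθ'₀, hθ'₁⟩ := G.mem_Ioo
  have hya : y / θ ≤ a + θ' - 1 := by
    rw [div_le_iff₀ hθ]
    linarith [hy.2]
  set j := ⌊y / θ⌋₊
  have hj : (j : ℝ) ≤ y / θ := Nat.floor_le (div_nonneg hy.1 hθ.le)
  have hj' : y / θ < j + 1 := Nat.lt_floor_add_one _
  rcases le_or_gt (y / θ - j) θ' with hc | hc
  · have hja : (j : ℝ) + 1 ≤ a := by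
      have : (j : ℝ) < a := by linarith
      exact_mod_cast this
    refine (H.high (1 - (y / θ - j)) ⟨by linarith, by linarith⟩).of_renormalized G hv j
      fun z ⟨hball, hz⟩ _ => ?_
    rw [mem_Ici] at hz
    exact ⟨by nlinarith, mem_closedBall_of_renormalized hθ hball, by rw [mem_Iic]; nlinarith⟩
  · have hja : (j : ℝ) + 2 ≤ a := by
      have : (j : ℝ) + 1 < a := by linarith
      exact_mod_cast this
    refine (H.low (1 - (y / θ - j)) ⟨by linarith, by linarith⟩).of_renormalized G hv j
      fun z ⟨hball, _⟩ ⟨hz, _⟩ => ?_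
    exact ⟨by nlinarith, mem_closedBall_of_renormalized hθ hball, by rw [mem_Iic]; nlinarith⟩

lemma high_of_renormalized (H : Recurs θ' v h ε N) (G : IsEvenGaussStep a θ θ')
    (hv : Involutive v) {y : ℝ} (hy : y ∈ Icc (1 - θ) 1) :
    HitsWithin θ h v (closedBall y (θ * ε) ∩ Ici (1 - θ)) ((N + 2) / θ) := by
  have hθ := G.pos
  have hG := G.add_mul_eq_one
  obtain ⟨hθ'₀, hθ'₁⟩ := G.mem_Ioo
  have hya : a - 1 + θ' ≤ y / θ := by
    rw [le_div_iff₀ hθ]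
    linarith [hy.1]
  have hya' : y / θ ≤ a + θ' := by
    rw [div_le_iff₀ hθ]
    linarith [hy.2]
  rcases le_total (a : ℝ) (y / θ) with hc | hc
  · refine (H.high (1 - (y / θ - a)) ⟨by linarith, by linarith⟩).of_renormalized G hv a
      fun z ⟨hball, hz⟩ ⟨_, hz₁⟩ => ?_
    rw [mem_Ici] at hz
    exact ⟨by nlinarith, mem_closedBall_of_renormalized hθ hball, by rw [mem_Ici]; nlinarith⟩
  · obtain ⟨b, rfl, -⟩ := G.exists_eq_succ
    push_cast at hG hya hc
    refine (H.low (1 - (y / θ - b)) ⟨by linarith, by linarith⟩).of_renormalized G hv b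
      fun z ⟨hball, hz⟩ ⟨hz₀, _⟩ => ?_
    rw [mem_Iic] at hz
    exact ⟨by nlinarith, mem_closedBall_of_renormalized hθ hball, by rw [mem_Ici]; nlinarith⟩

lemma of_renormalized (H : Recurs θ' v h ε N) (G : IsEvenGaussStep a θ θ') (hv : Involutive v) :
    Recurs θ h v (θ * ε) ((N + 2) / θ) :=
  ⟨fun _ => H.low_of_renormalized G hv, fun _ => H.high_of_renormalized G hv⟩

end Recurs

section EvenExpansion

variable {X : Type*} {h v : X → X} {a : ℕ → ℕ} {θ : ℕ → ℝ} {D : ℝ}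

lemma exists_forall_recurs_one (E : ∀ k, IsEvenGaussStep (a k) (θ k) (θ (k + 1)))
    (hD : ∀ k, (θ k)⁻¹ ≤ D) :
    ∃ N : ℝ, 0 < N ∧
      ∀ k (h v : X → X), IsTranspositionPair h v → Recurs (θ k) h v 1 N := by
  have hDpos : 0 < D := (inv_pos.2 (E 0).pos).trans_le (hD 0)
  have div_le : ∀ k {M M' : ℝ}, 0 ≤ M' → M ≤ M' → M / θ k ≤ M' * D := fun k M M' h₀ hM => by
    rw [div_eq_mul_inv]
    exact mul_le_mul hM (hD k) (inv_nonneg.2 (E k).pos.le) h₀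
  have hits_univ : ∀ k (h v : X → X), IsTranspositionPair h v →
      HitsWithin (θ k) h v univ ((D + 5) * D) := fun k h v T =>
    (hitsWithin_univ (E k) T).mono (subset_univ _)
      (div_le k (by positivity) (by rw [one_div]; linarith [hD (k + 1)]))
  have hits_low : ∀ k (h v : X → X), IsTranspositionPair h v →
      HitsWithin (θ k) h v (Iic (1 - θ k)) (((D + 5) * D + 2) * D) := fun k h v T =>
    ((hits_univ (k + 1) v h T.symm).Iic_of_renormalized (E k) T.involutive_right).mono
      inter_subset_left (div_le k (by positivity) le_rfl)
  have hits_high : ∀ k (h v : X → X), IsTranspositionPair h v →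
      HitsWithin (θ k) h v (Ici (1 - θ k)) ((((D + 5) * D + 2) * D + 2) * D) := fun k h v T =>
    ((hits_low (k + 1) v h T.symm).Ici_of_renormalized (E k) T.involutive_right).mono
      inter_subset_left (div_le k (by positivity) le_rfl)
  have two_le : 2 ≤ D :=
    ((le_inv_comm₀ two_pos (E 0).pos).2 (by linarith [(E 0).le_half])).trans (hD 0)
  refine ⟨(((D + 5) * D + 2) * D + 2) * D, by positivity, fun k h v T =>
    .of_hitsWithin (E k).pos.le (by linarith [(E k).le_half])
      ((hits_low k h v T).mono inter_subset_left ?_) (hits_high k h v T)⟩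
  calc ((D + 5) * D + 2) * D ≤ ((D + 5) * D + 2) * D + 2 := by linarith
    _ ≤ (((D + 5) * D + 2) * D + 2) * D := le_mul_of_one_le_right (by positivity) (by linarith)

/-- By induction on a bound `2 ^ n` for the scale `K`, as `K * θ k ≤ K / 2` is the scale to be
treated after one renormalization. -/
lemma exists_forall_recurs (E : ∀ k, IsEvenGaussStep (a k) (θ k) (θ (k + 1)))
    (hD : ∀ k, (θ k)⁻¹ ≤ D) :
    ∃ C : ℝ, 0 < C ∧ ∀ (n k : ℕ) (h v : X → X) (K : ℝ), IsTranspositionPair h v →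
      1 ≤ K → K < 2 ^ n → Recurs (θ k) h v (1 / K) (C * K - 4) := by
  obtain ⟨N, hN, base⟩ := exists_forall_recurs_one (X := X) E hD
  have hDpos : 0 < D := (inv_pos.2 (E 0).pos).trans_le (hD 0)
  refine ⟨(N + 2) * D + 4, by positivity, fun n => ?_⟩
  induction n with
  | zero => exact fun k h v K _ h₁ h₂ => absurd h₂ (by rw [pow_zero]; exact h₁.not_gt)
  | succ n ih =>
    intro k h v K T hK hKn
    have hθ := (E k).pos
    have hhalf := (E k).le_half
    rcases le_or_gt 1 (K * θ k) with hKθ | hKθ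
    · have hKθn : K * θ k < 2 ^ n := by
        rw [pow_succ] at hKn
        nlinarith
      refine ((ih (k + 1) v h _ T.symm hKθ hKθn).of_renormalized (E k) T.involutive_right).mono
        (by field_simp; rfl) ?_
      rw [div_le_iff₀ hθ]
      nlinarith
    · refine ((base (k + 1) v h T.symm).of_renormalized (E k) T.involutive_right).mono ?_ ?_
      · rw [mul_one, le_div_iff₀ (by linarith)]
        linarith
      · calc (N + 2) / θ k ≤ (N + 2) * D := by
              rw [div_eq_mul_inv]
              gcongr
              exact hD k
          _ ≤ (N + 2) * D * K := le_mul_of_one_le_right (by positivity) hK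
          _ ≤ ((N + 2) * D + 4) * K - 4 := by linarith

lemma exists_hitsWithin_closedBall (E : ∀ k, IsEvenGaussStep (a k) (θ k) (θ (k + 1)))
    (hD : ∀ k, (θ k)⁻¹ ≤ D) (T : IsTranspositionPair h v) :
    ∃ C : ℝ, 0 < C ∧ ∀ K : ℝ, 1 ≤ K → ∀ y ∈ Icc (0 : ℝ) 1,
      HitsWithin (θ 0) h v (closedBall y (1 / K)) (C * K) := by
  obtain ⟨C, hC, recurs⟩ := exists_forall_recurs (X := X) E hD
  refine ⟨C, hC, fun K hK y hy => ?_⟩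
  obtain ⟨n, hn⟩ := pow_unbounded_of_one_lt K one_lt_two
  exact ((recurs n 0 h v K T hK hn).mono le_rfl (by linarith)).hitsWithin_closedBall hy

end EvenExpansion

section ContinuedFractions

open GenContFract

/-- The `k`-th iterate of `α⁻¹` under the Gauss map; for `1 < α` these are the inverses of the
complete quotients of `α`. -/
def gaussIterate (α : ℝ) (k : ℕ) : ℝ :=
  (fun x => Int.fract x⁻¹)^[k] α⁻¹

lemma gaussIterate_succ (α : ℝ) (k : ℕ) :
    gaussIterate α (k + 1) = Int.fract (gaussIterate α k)⁻¹ :=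
  iterate_succ_apply' _ _ _

variable {α : ℝ} {a : ℕ → ℕ}

lemma eq_of_stream_eq_some {k : ℕ} {p : IntFractPair ℝ} (hp : IntFractPair.stream α k = some p) :
    p = IntFractPair.of (gaussIterate α k)⁻¹ := by
  induction k generalizing p with
  | zero =>
    rw [gaussIterate, iterate_zero_apply, inv_inv]
    exact (Option.some.inj hp).symm
  | succ k ih =>
    obtain ⟨q, hq, -, rfl⟩ := IntFractPair.succ_nth_stream_eq_some_iff.1 hp
    rw [ih hq, gaussIterate_succ]
    rfl

lemma HasContFracDigits.eq_floor (ha : HasContFracDigits α a) (k : ℕ) :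
    (a k : ℝ) = ⌊(gaussIterate α k)⁻¹⌋ := by
  cases k with
  | zero => rw [← ha.1, of_h_eq_floor, gaussIterate, iterate_zero_apply, inv_inv]
  | succ k =>
    obtain ⟨g, hg, hgb⟩ := exists_s_b_of_partDen (ha.2 k)
    obtain ⟨p, hp, hpb⟩ :=
      IntFractPair.exists_succ_get?_stream_of_gcf_of_get?_eq_some hg
    rw [← hgb, ← hpb, eq_of_stream_eq_some hp]
    rfl

lemma HasContFracDigits.add_gaussIterate_succ (ha : HasContFracDigits α a) (k : ℕ) :
    a k + gaussIterate α (k + 1) = (gaussIterate α k)⁻¹ := by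
  rw [ha.eq_floor, gaussIterate_succ, Int.floor_add_fract]

lemma HasContFracDigits.isEvenGaussStep (ha : HasContFracDigits α a)
    (hdigits : ∀ i, 0 < a i ∧ Even (a i)) (k : ℕ) :
    IsEvenGaussStep (a k) (gaussIterate α k) (gaussIterate α (k + 1)) := by
  have two_le : ∀ i, 2 ≤ a i := fun i => by
    obtain ⟨hpos, r, hr⟩ := hdigits i
    omega
  have gaussIterate_pos : ∀ i, 0 < gaussIterate α i := fun i => by
    have hfloor : (0 : ℝ) < ⌊(gaussIterate α i)⁻¹⌋ := by
      rw [← ha.eq_floor]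
      exact_mod_cast (hdigits i).1
    exact inv_pos.1 (hfloor.trans_le (Int.floor_le _))
  refine ⟨(hdigits k).2, two_le k, ⟨gaussIterate_pos _, ?_⟩, ?_⟩
  · rw [gaussIterate_succ]
    exact Int.fract_lt_one _
  · rw [ha.add_gaussIterate_succ, inv_mul_cancel₀ (gaussIterate_pos k).ne']

lemma IsBadlyApproximable.exists_inv_gaussIterate_le (hbad : IsBadlyApproximable α)
    (ha : HasContFracDigits α a) : ∃ D, ∀ k, (gaussIterate α k)⁻¹ ≤ D := by
  obtain ⟨M, hM⟩ := hbad.2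
  refine ⟨max (a 0 : ℝ) M + 1, fun k => ?_⟩
  have digit_le : (a k : ℝ) ≤ max (a 0 : ℝ) M := by
    cases k with
    | zero => exact le_max_left _ _
    | succ k => exact (hM k _ (ha.2 k)).trans (le_max_right _ _)
  have fract_le : gaussIterate α (k + 1) ≤ 1 := by
    rw [gaussIterate_succ]
    exact (Int.fract_lt_one _).le
  rw [← ha.add_gaussIterate_succ]
  exact add_le_add digit_le fract_le

end ContinuedFractions

namespace LSurface

local notation "ℝ²" => EuclideanSpace ℝ (Fin 2)

/-- The lower left corners of the three squares, in the order in which squares are numbered. -/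
def corner : Fin 3 → ℝ² := ![!₂[0, 0], !₂[1, 0], !₂[0, 1]]

/-- The center of the unit square. -/
def unitCenter : ℝ² := WithLp.toLp 2 fun _ => 1 / 2

/-- The point with local coordinates `q` in the square `s`. For `σ = 1` these are measured from
the lower left corner, for `σ = -1` from the upper right corner in the opposite directions, so that
the direction of motion can always be taken to be positive. -/
def chart (σ : ℤˣ) (s : Fin 3) (q : ℝ²) : ℝ² :=
  corner s + (unitCenter + σ • (q - unitCenter))

/-- The square to the right (equivalently, to the left) of a square. -/
def right : Fin 3 → Fin 3 := ![1, 0, 2]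

/-- The square above (equivalently, below) a square. -/
def up : Fin 3 → Fin 3 := ![2, 1, 0]

lemma isTranspositionPair_right_up : IsTranspositionPair right up :=
  ⟨0, 1, 2, by decide, rfl, rfl, rfl, rfl, rfl, rfl⟩

section Chart

variable {σ : ℤˣ} {s s' : Fin 3} {q q' : ℝ²}

lemma chart_apply (σ : ℤˣ) (s : Fin 3) (q : ℝ²) (i : Fin 2) :
    chart σ s q i = corner s i + (1 / 2 + (σ : ℤ) * (q i - 1 / 2)) := by
  simp [chart, unitCenter, Units.smul_def]

lemma chart_one_apply (s : Fin 3) (q : ℝ²) (i : Fin 2) :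
    chart 1 s q i = (corner s i + q i : ℝ) := by
  rw [chart, one_smul, add_sub_cancel, PiLp.add_apply]

lemma chart_neg_one_apply (s : Fin 3) (q : ℝ²) (i : Fin 2) :
    chart (-1) s q i = (corner s i + 1 - q i : ℝ) := by
  rw [chart_apply, Units.val_neg, Units.val_one, Int.cast_neg, Int.cast_one]
  ring

lemma corner_apply_zero (s : Fin 3) : corner s 0 = (if s = 1 then 1 else 0 : ℝ) := by
  fin_cases s <;> simp [corner]

lemma corner_apply_one (s : Fin 3) : corner s 1 = (if s = 2 then 1 else 0 : ℝ) := by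
  fin_cases s <;> simp [corner]

lemma corner_apply_eq_or (s : Fin 3) (i : Fin 2) :
    corner s i = (0 : ℝ) ∨ corner s i = (1 : ℝ) := by
  fin_cases s <;> fin_cases i <;> simp [corner]

lemma chart_add_smul (σ : ℤˣ) (s : Fin 3) (q w : ℝ²) (u : ℝ) :
    chart σ s q + u • σ • w = chart σ s (q + u • w) := by
  rw [chart, chart, smul_comm u σ w, add_sub_right_comm, smul_add]
  abel

lemma dist_chart (σ : ℤˣ) (s : Fin 3) (q q' : ℝ²) :
    dist (chart σ s q) (chart σ s q') = dist q q' := by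
  rw [chart, chart, dist_add_left, dist_add_left]
  rcases Int.units_eq_one_or σ with rfl | rfl
  · rw [one_smul, one_smul, dist_sub_right]
  · simp only [Units.neg_smul, one_smul, dist_neg_neg, dist_sub_right]

lemma exists_eq_chart (σ : ℤˣ) (s : Fin 3) (p : ℝ²) : ∃ q, p = chart σ s q := by
  refine ⟨unitCenter + σ • (p - corner s - unitCenter), ?_⟩
  rw [chart, add_sub_cancel_left, smul_smul, Int.units_mul_self, one_smul]
  abel

lemma mem_LShape_iff {p : ℝ²} :
    p ∈ LShape ↔ 0 ≤ p 0 ∧ 0 ≤ p 1 ∧ (p 0 ≤ 2 ∧ p 1 ≤ 1 ∨ p 0 ≤ 1 ∧ p 1 ≤ 2) := by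
  simp only [LShape, mem_ofPred_eq, mem_Icc]
  tauto

lemma chart_mem (hq : ∀ i, q i ∈ Icc (0 : ℝ) 1) : chart σ s q ∈ LShape := by
  have h₀ := hq 0
  have h₁ := hq 1
  rw [mem_Icc] at h₀ h₁
  rw [mem_LShape_iff]
  rcases Int.units_eq_one_or σ with rfl | rfl <;>
    simp only [chart_one_apply, chart_neg_one_apply, corner_apply_zero, corner_apply_one] <;>
    grind

lemma segment_chart_subset (hq : ∀ i, q i ∈ Icc (0 : ℝ) 1) (hq' : ∀ i, q' i ∈ Icc (0 : ℝ) 1) :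
    segment ℝ (chart σ s q) (chart σ s q') ⊆ LShape := by
  rintro _ ⟨a, b, ha, hb, hab, rfl⟩
  have affine : a • chart σ s q + b • chart σ s q' = chart σ s (a • q + b • q') := by
    ext i
    obtain rfl : b = 1 - a := by linarith
    simp only [PiLp.add_apply, PiLp.smul_apply, smul_eq_mul, chart_apply]
    ring
  rw [affine]
  exact chart_mem fun i => convex_Icc (0 : ℝ) 1 (hq i) (hq' i) ha hb hab

lemma chart_injective (hq : ∀ i, q i ∈ Ico (0 : ℝ) 1) (hq' : ∀ i, q' i ∈ Ico (0 : ℝ) 1)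
    (h : chart σ s q = chart σ s' q') : s = s' ∧ q = q' := by
  obtain rfl : s = s' := by
    have hx := hq 0
    have hy := hq 1
    have hx' := hq' 0
    have hy' := hq' 1
    have h₀ := congrArg (· 0) h
    have h₁ := congrArg (· 1) h
    rcases Int.units_eq_one_or σ with rfl | rfl <;>
      simp only [chart_one_apply, chart_neg_one_apply, corner_apply_zero, corner_apply_one, mem_Ico]
        at hx hy hx' hy' h₀ h₁ <;>
      -- The coordinates have type `(fun _ => ℝ) i`, which `grind` does not reduce.
      beta_reduce at * <;>
      grind
  refine ⟨rfl, ?_⟩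
  rw [← dist_eq_zero, ← dist_chart σ s, h, dist_self]

end Chart

section Representatives

variable {σ : ℤˣ} {s : Fin 3} {q : ℝ²}

lemma exists_eq_chart_Icc (σ : ℤˣ) {p : ℝ²} (hp : p ∈ LShape) :
    ∃ s q, (∀ i, q i ∈ Icc (0 : ℝ) 1) ∧ p = chart σ s q := by
  obtain ⟨q, hq⟩ := exists_eq_chart σ (if 1 < p 0 then 1 else if 1 < p 1 then 2 else 0) p
  refine ⟨_, q, Fin.forall_fin_two.2 ?_, hq⟩
  have h₀ := congrArg (· 0) hq
  have h₁ := congrArg (· 1) hq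
  rw [mem_LShape_iff] at hp
  rcases Int.units_eq_one_or σ with rfl | rfl <;>
    simp only [chart_one_apply, chart_neg_one_apply, corner_apply_zero, corner_apply_one, mem_Icc]
      at h₀ h₁ ⊢ <;>
    beta_reduce at * <;>
    grind

lemma exists_eq_chart_Ico {p d : ℝ²} (hd : ∀ i, 0 < d i) (hp : p ∈ LShape)
    (hpd : p + σ • d ∈ LShape) : ∃ s q, (∀ i, q i ∈ Ico (0 : ℝ) 1) ∧ p = chart σ s q := by
  have hd₀ := hd 0
  have hd₁ := hd 1
  rw [mem_LShape_iff] at hp hpd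
  rcases Int.units_eq_one_or σ with rfl | rfl
  · obtain ⟨q, hq⟩ := exists_eq_chart 1 (if 1 ≤ p 0 then 1 else if 1 ≤ p 1 then 2 else 0) p
    refine ⟨_, q, Fin.forall_fin_two.2 ?_, hq⟩
    have h₀ := congrArg (· 0) hq
    have h₁ := congrArg (· 1) hq
    simp only [chart_one_apply, corner_apply_zero, corner_apply_one, one_smul, PiLp.add_apply,
      mem_Ico] at h₀ h₁ hpd ⊢
    beta_reduce at *
    grind
  · obtain ⟨q, hq⟩ := exists_eq_chart (-1) (if 1 < p 0 then 1 else if 1 < p 1 then 2 else 0) p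
    refine ⟨_, q, Fin.forall_fin_two.2 ?_, hq⟩
    have h₀ := congrArg (· 0) hq
    have h₁ := congrArg (· 1) hq
    simp only [chart_neg_one_apply, corner_apply_zero, corner_apply_one, Units.neg_smul, one_smul,
      PiLp.add_apply, PiLp.neg_apply, mem_Ico] at h₀ h₁ hpd ⊢
    beta_reduce at *
    grind

/-- The possible integer coordinates of points of the net. -/
def IsGrid (r : ℝ) : Prop := r = 0 ∨ r = 1 ∨ r = 2

lemma isVertex_mk {p : LShape} (hp : ∀ i, IsGrid (p.1 i)) : (mk p).IsVertex := by
  have exists_int : ∀ r : ℝ, IsGrid r → ∃ n : ℤ, r = n := by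
    rintro r (rfl | rfl | rfl)
    exacts [⟨0, by simp⟩, ⟨1, by simp⟩, ⟨2, by simp⟩]
  obtain ⟨m, hm⟩ := exists_int _ (hp 0)
  obtain ⟨n, hn⟩ := exists_int _ (hp 1)
  exact ⟨p, m, n, hm, hn, rfl⟩

lemma isGrid_chart {i : Fin 2} (hq : q i = 0 ∨ q i = 1) : IsGrid (chart σ s q i) := by
  rcases Int.units_eq_one_or σ with rfl | rfl <;> rcases corner_apply_eq_or s i with hs | hs <;>
    rcases hq with hq | hq <;>
    simp only [IsGrid, chart_one_apply, chart_neg_one_apply, hs, hq] <;> norm_num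

lemma not_isGrid_chart {i : Fin 2} (hq : q i ∈ Ioo (0 : ℝ) 1) : ¬ IsGrid (chart σ s q i) := by
  rw [mem_Ioo] at hq
  rcases Int.units_eq_one_or σ with rfl | rfl <;> rcases corner_apply_eq_or s i with hs | hs <;>
    simp only [IsGrid, chart_one_apply, chart_neg_one_apply, hs] <;> grind

lemma congr_of_mk_eq {β : Type*} (φ : LShape → β) (hφ : ∀ p q, LGlue p q → φ p = φ q)
    {p q : LShape} (h : mk p = mk q) : φ p = φ q :=
  congrArg (Quot.lift φ hφ) h

open Classical in
lemma eq_of_mk_eq_of_not_isGrid {p q : LShape} (h : mk p = mk q) (hq : ∀ i, ¬ IsGrid (q.1 i)) :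
    p.1 = q.1 := by
  have interior_eq := congr_of_mk_eq
    (fun p : LShape => if IsGrid (p.1 0) ∨ IsGrid (p.1 1) then none else some p.1)
    (by rintro p q (⟨-, -, h₁, h₂⟩ | ⟨-, -, h₁, h₂⟩ | ⟨-, -, h₁, h₂⟩ | ⟨-, -, h₁, h₂⟩) <;>
      simp [IsGrid, h₁, h₂]) h
  have := hq 0
  have := hq 1
  grind

/-- A coordinate `x` of a point of the net, with other coordinate `y`, after moving the point to the
lower or left edge of a square if `σ = 1`, to the upper or right edge if `σ = -1`. -/
def normalCoord (σ : ℤˣ) (x y : ℝ) : ℝ :=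
  if σ = 1 then (if x = 2 ∨ (x = 1 ∧ 1 < y) then 0 else x)
  else (if x = 0 then (if y ≤ 1 then 2 else 1) else x)

open Classical in
/-- The representative of a point of the surface which has local coordinates in `[0, 1)`;
`none` at the vertices, which may have several such representatives. -/
def normalForm (σ : ℤˣ) (p : LShape) : Option (ℝ × ℝ) :=
  if IsGrid (p.1 0) ∧ IsGrid (p.1 1) then none
  else some (normalCoord σ (p.1 0) (p.1 1), normalCoord σ (p.1 1) (p.1 0))

lemma normalForm_congr (σ : ℤˣ) (p q : LShape) (h : LGlue p q) :
    normalForm σ p = normalForm σ q := by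
  rcases h with ⟨h₀, h₁, h₂, h₃⟩ | ⟨h₀, h₁, h₂, h₃⟩ | ⟨h₀, h₁, h₂, h₃⟩ | ⟨h₀, h₁, h₂, h₃⟩ <;>
    simp only [normalForm, normalCoord, IsGrid, h₁, h₂, h₃, mem_Icc] at h₀ ⊢ <;> grind

lemma normalForm_chart {p : LShape} (hp : p.1 = chart σ s q) (hq : ∀ i, q i ∈ Ico (0 : ℝ) 1)
    (hv : ¬ (mk p).IsVertex) : normalForm σ p = some (p.1 0, p.1 1) := by
  have not_grid : ¬ (IsGrid (p.1 0) ∧ IsGrid (p.1 1)) :=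
    fun h => hv (isVertex_mk (Fin.forall_fin_two.2 h))
  have h₀ := hq 0
  have h₁ := hq 1
  rw [normalForm, if_neg not_grid]
  have neg_one_ne : (-1 : ℤˣ) ≠ 1 := by decide
  rw [hp, Option.some_inj, Prod.mk_inj]
  rcases Int.units_eq_one_or σ with rfl | rfl <;>
    simp only [normalCoord, chart_one_apply, chart_neg_one_apply, corner_apply_zero,
      corner_apply_one, mem_Ico] at h₀ h₁ ⊢ <;>
    beta_reduce at * <;>
    grind

end Representatives

section Coordinates

variable {σ : ℤˣ} {s : Fin 3} {q q' : ℝ²} {z z' x y : LSurface} {ℓ ℓ' : ℝ}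

/-- `z` is the point with local coordinates `q` in the square `s`. -/
def HasCoords (z : LSurface) (σ : ℤˣ) (s : Fin 3) (q : ℝ²) : Prop :=
  ∃ p : LShape, p.1 = chart σ s q ∧ mk p = z

lemma right_eq_one_iff : right s = 1 ↔ s = 0 := by decide +revert

lemma right_eq_two_iff : right s = 2 ↔ s = 2 := by decide +revert

lemma up_eq_one_iff : up s = 1 ↔ s = 1 := by decide +revert

lemma up_eq_two_iff : up s = 2 ↔ s = 0 := by decide +revert

lemma lGlue_iff {p p' : LShape} : LGlue p p' ↔
    p'.1 0 = p.1 0 ∧ p.1 1 = 0 ∧ (p.1 0 ∈ Icc 0 1 ∧ p'.1 1 = 2 ∨ p.1 0 ∈ Icc 1 2 ∧ p'.1 1 = 1) ∨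
      p'.1 1 = p.1 1 ∧ p.1 0 = 0 ∧
        (p.1 1 ∈ Icc 0 1 ∧ p'.1 0 = 2 ∨ p.1 1 ∈ Icc 1 2 ∧ p'.1 0 = 1) := by
  constructor
  · rintro (_ | _ | _ | _) <;> tauto
  · rintro (⟨h, h₁, ⟨h₀, h₂⟩ | ⟨h₀, h₂⟩⟩ | ⟨h, h₁, ⟨h₀, h₂⟩ | ⟨h₀, h₂⟩⟩)
    exacts [.h₁ p p' h₀ h h₁ h₂, .h₂ p p' h₀ h h₁ h₂, .v₁ p p' h₀ h h₁ h₂, .v₂ p p' h₀ h h₁ h₂]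

lemma mk_eq_mk_of_eq_or_lGlue {p p' : LShape}
    (h : p.1 0 = p'.1 0 ∧ p.1 1 = p'.1 1 ∨ LGlue p p' ∨ LGlue p' p) : mk p = mk p' := by
  rcases h with ⟨h₀, h₁⟩ | h | h
  · exact congrArg mk (Subtype.ext (PiLp.ext (Fin.forall_fin_two.2 ⟨h₀, h₁⟩)))
  · exact Quot.sound h
  · exact (Quot.sound h).symm

lemma mk_eq_mk_right {p p' : LShape} (hp : p.1 = chart σ s q)
    (hp' : p'.1 = chart σ (right s) (q - !₂[1, 0])) (h₀ : q 0 = 1) (h₁ : q 1 ∈ Icc (0 : ℝ) 1) :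
    mk p = mk p' := by
  apply mk_eq_mk_of_eq_or_lGlue
  have sub_zero : (q - !₂[1, 0] : ℝ²) 0 = 0 := by simp [h₀]
  have sub_one : (q - !₂[1, 0] : ℝ²) 1 = q 1 := by simp
  rw [mem_Icc] at h₁
  rcases Int.units_eq_one_or σ with rfl | rfl <;>
    simp only [lGlue_iff, hp, hp', chart_one_apply, chart_neg_one_apply, corner_apply_zero,
      corner_apply_one, right_eq_one_iff, right_eq_two_iff, h₀, sub_zero, sub_one,
      mem_Icc] <;>
    beta_reduce at * <;>
    grind

lemma mk_eq_mk_up {p p' : LShape} (hp : p.1 = chart σ s q)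
    (hp' : p'.1 = chart σ (up s) (q - !₂[0, 1])) (h₀ : q 0 ∈ Icc (0 : ℝ) 1) (h₁ : q 1 = 1) :
    mk p = mk p' := by
  apply mk_eq_mk_of_eq_or_lGlue
  have sub_zero : (q - !₂[0, 1] : ℝ²) 0 = q 0 := by simp
  have sub_one : (q - !₂[0, 1] : ℝ²) 1 = 0 := by simp [h₁]
  rw [mem_Icc] at h₀
  rcases Int.units_eq_one_or σ with rfl | rfl <;>
    simp only [lGlue_iff, hp, hp', chart_one_apply, chart_neg_one_apply, corner_apply_zero,
      corner_apply_one, up_eq_one_iff, up_eq_two_iff, h₁, sub_zero, sub_one,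
      mem_Icc] <;>
    beta_reduce at * <;>
    grind

namespace HasCoords

lemma right (hz : HasCoords z σ s q) (h₀ : q 0 = 1) (h₁ : q 1 ∈ Icc (0 : ℝ) 1) :
    HasCoords z σ (right s) (q - !₂[1, 0]) := by
  obtain ⟨p, hp, rfl⟩ := hz
  have mem_unit : ∀ i, (q - !₂[1, 0] : ℝ²) i ∈ Icc (0 : ℝ) 1 :=
    Fin.forall_fin_two.2 ⟨by simp [h₀], by simpa using h₁⟩
  exact ⟨⟨_, chart_mem mem_unit⟩, rfl, (mk_eq_mk_right hp rfl h₀ h₁).symm⟩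

lemma up (hz : HasCoords z σ s q) (h₀ : q 0 ∈ Icc (0 : ℝ) 1) (h₁ : q 1 = 1) :
    HasCoords z σ (up s) (q - !₂[0, 1]) := by
  obtain ⟨p, hp, rfl⟩ := hz
  have mem_unit : ∀ i, (q - !₂[0, 1] : ℝ²) i ∈ Icc (0 : ℝ) 1 :=
    Fin.forall_fin_two.2 ⟨by simpa using h₀, by simp [h₁]⟩
  exact ⟨⟨_, chart_mem mem_unit⟩, rfl, (mk_eq_mk_up hp rfl h₀ h₁).symm⟩

lemma isVertex (hz : HasCoords z σ s q) (hq : ∀ i, q i = 0 ∨ q i = 1) : z.IsVertex := by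
  obtain ⟨p, hp, rfl⟩ := hz
  exact isVertex_mk fun i => hp ▸ isGrid_chart (hq i)

lemma unique {s' : Fin 3} (hz : HasCoords z σ s q) (hz' : HasCoords z σ s' q')
    (hq : ∀ i, q i ∈ Ico (0 : ℝ) 1) (hq' : ∀ i, q' i ∈ Ico (0 : ℝ) 1) (hv : ¬ z.IsVertex) :
    s = s' ∧ q = q' := by
  obtain ⟨p, hp, rfl⟩ := hz
  obtain ⟨p', hp', hpp'⟩ := hz'
  have normal_eq := congr_of_mk_eq (normalForm σ) (normalForm_congr σ) hpp'
  rw [normalForm_chart hp hq hv, normalForm_chart hp' hq' (hpp' ▸ hv)] at normal_eq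
  obtain ⟨h₀, h₁⟩ := Prod.mk.inj (Option.some.inj normal_eq)
  refine chart_injective (σ := σ) hq hq' ?_
  rw [← hp, ← hp']
  exact PiLp.ext (Fin.forall_fin_two.2 ⟨h₀.symm, h₁.symm⟩)

end HasCoords

lemma exists_hasCoords (σ : ℤˣ) (z : LSurface) :
    ∃ s q, (∀ i, q i ∈ Icc (0 : ℝ) 1) ∧ HasCoords z σ s q := by
  obtain ⟨p, rfl⟩ := Quot.exists_rep z
  obtain ⟨s, q, hq, hp⟩ := exists_eq_chart_Icc σ p.2
  exact ⟨s, q, hq, p, hp, rfl⟩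

lemma IsPath.trans (hxy : IsPath x y ℓ) (hyz : IsPath y z ℓ') : IsPath x z (ℓ + ℓ') := by
  induction hyz with
  | nil => rwa [add_zero]
  | step p q _ hpq ih =>
    rw [← add_assoc]
    exact .step p q ih hpq

lemma IsPath.symm (hxy : IsPath x y ℓ) : IsPath y x ℓ := by
  induction hxy with
  | nil => exact .nil
  | step p q _ hpq ih =>
    have back := IsPath.step q p .nil (by rwa [segment_symm])
    rw [zero_add, dist_comm] at back
    rw [add_comm]
    exact back.trans ih

lemma HasCoords.isPath (hz : HasCoords z σ s q) (hz' : HasCoords z' σ s q')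
    (hq : ∀ i, q i ∈ Icc (0 : ℝ) 1) (hq' : ∀ i, q' i ∈ Icc (0 : ℝ) 1) :
    IsPath z z' (dist q q') := by
  obtain ⟨p, hp, rfl⟩ := hz
  obtain ⟨p', hp', rfl⟩ := hz'
  have := IsPath.step p p' .nil (by rw [hp, hp']; exact segment_chart_subset hq hq')
  rwa [zero_add, hp, hp', dist_chart] at this

/-- `z` has coordinates `q` in the rectangle formed by the square `s` and the square to its
right. -/
def InStrip (z : LSurface) (σ : ℤˣ) (s : Fin 3) (q : ℝ²) : Prop :=
  (q 0 ∈ Icc (0 : ℝ) 1 ∧ HasCoords z σ s q) ∨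
    (q 0 ∈ Icc (1 : ℝ) 2 ∧ HasCoords z σ (LSurface.right s) (q - !₂[1, 0]))

lemma dist_eq_of_apply_one_eq (h : q 1 = q' 1) : dist q q' = |q 0 - q' 0| := by
  rw [EuclideanSpace.dist_eq, Fin.sum_univ_two, h, dist_self, Real.dist_eq]
  simp [Real.sqrt_sq_eq_abs]

lemma sub_mem_unit (h₀ : q 0 ∈ Icc (1 : ℝ) 2) (h₁ : q 1 ∈ Icc (0 : ℝ) 1) :
    ∀ i, (q - !₂[1, 0] : ℝ²) i ∈ Icc (0 : ℝ) 1 :=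
  Fin.forall_fin_two.2 ⟨by simpa [one_add_one_eq_two] using h₀, by simpa using h₁⟩

lemma HasCoords.isPath_right (hz : HasCoords z σ s q)
    (hz' : HasCoords z' σ (LSurface.right s) (q' - !₂[1, 0])) (h₀ : q 0 ∈ Icc (0 : ℝ) 1)
    (h₀' : q' 0 ∈ Icc (1 : ℝ) 2) (h : q 1 = q' 1) (h₁ : q 1 ∈ Icc (0 : ℝ) 1) :
    IsPath z z' |q 0 - q' 0| := by
  have mem_unit : ∀ i, (!₂[1, q 1] : ℝ²) i ∈ Icc (0 : ℝ) 1 :=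
    Fin.forall_fin_two.2 ⟨right_mem_Icc.2 zero_le_one, h₁⟩
  have mid : HasCoords (mk ⟨_, chart_mem (σ := σ) (s := s) mem_unit⟩) σ s !₂[1, q 1] :=
    ⟨_, rfl, rfl⟩
  have mid_mem : (!₂[1, q 1] : ℝ²) 0 ∈ Icc (1 : ℝ) 2 := ⟨le_rfl, one_le_two⟩
  have path := (hz.isPath mid (Fin.forall_fin_two.2 ⟨h₀, h₁⟩) mem_unit).trans
    ((mid.right rfl h₁).isPath hz' (sub_mem_unit mid_mem h₁) (sub_mem_unit h₀' (h ▸ h₁)))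
  rw [dist_sub_right, dist_eq_of_apply_one_eq (q := q) (q' := !₂[1, q 1]) rfl,
    dist_eq_of_apply_one_eq (q := !₂[1, q 1]) (q' := q') h] at path
  convert path using 1
  change _ = |q 0 - 1| + |1 - q' 0|
  rw [abs_of_nonpos (sub_nonpos.2 h₀.2), abs_of_nonpos (sub_nonpos.2 h₀'.1),
    abs_of_nonpos (sub_nonpos.2 (h₀.2.trans h₀'.1))]
  ring

lemma InStrip.isPath (hz : InStrip z σ s q) (hz' : InStrip z' σ s q') (h : q 1 = q' 1)
    (h₁ : q 1 ∈ Icc (0 : ℝ) 1) : IsPath z z' |q 0 - q' 0| := by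
  have h₁' : q' 1 ∈ Icc (0 : ℝ) 1 := h ▸ h₁
  rcases hz with hz | hz <;> rcases hz' with hz' | hz'
  · rw [← dist_eq_of_apply_one_eq h]
    exact hz.2.isPath hz'.2 (Fin.forall_fin_two.2 ⟨hz.1, h₁⟩) (Fin.forall_fin_two.2 ⟨hz'.1, h₁'⟩)
  · exact hz.2.isPath_right hz'.2 hz.1 hz'.1 h h₁
  · rw [abs_sub_comm]
    exact (hz'.2.isPath_right hz.2 hz'.1 hz.1 h.symm h₁').symm
  · rw [← dist_eq_of_apply_one_eq h, ← dist_sub_right q q' !₂[1, 0]]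
    exact hz.2.isPath hz'.2 (sub_mem_unit hz.1 h₁) (sub_mem_unit hz'.1 h₁')

lemma exists_inStrip (σ : ℤˣ) (z : LSurface) {θ : ℝ} (hθ : θ ∈ Icc (0 : ℝ) 1) :
    ∃ s, ∃ y ∈ Icc (0 : ℝ) 1, ∃ b ∈ Icc (0 : ℝ) 1, InStrip z σ s !₂[y + b * θ, b] := by
  obtain ⟨s, q, hq, hz⟩ := exists_hasCoords σ z
  obtain ⟨h₀, h₀'⟩ := hq 0
  obtain ⟨h₁, h₁'⟩ := hq 1
  have hpos : 0 ≤ q 1 * θ := mul_nonneg h₁ hθ.1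
  have hle : q 1 * θ ≤ 1 := mul_le_one₀ h₁' hθ.1 hθ.2
  rcases le_total (q 1 * θ) (q 0) with h | h
  · have coords : !₂[q 0, q 1] = q := PiLp.ext (Fin.forall_fin_two.2 ⟨rfl, rfl⟩)
    refine ⟨s, q 0 - q 1 * θ, ⟨by linarith, by linarith⟩, q 1, hq 1, Or.inl ?_⟩
    rw [sub_add_cancel, coords]
    exact ⟨hq 0, hz⟩
  · have coords : (!₂[q 0 + 1, q 1] - !₂[1, 0] : ℝ²) = q :=
      PiLp.ext (Fin.forall_fin_two.2 ⟨by simp, by simp⟩)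
    refine ⟨LSurface.right s, q 0 + 1 - q 1 * θ, ⟨by linarith, by linarith⟩, q 1, hq 1, Or.inr ?_⟩
    rw [sub_add_cancel, coords, isTranspositionPair_right_up.involutive_left s]
    exact ⟨⟨by simpa using h₀, by change q 0 + 1 ≤ 2; linarith⟩, hz⟩

end Coordinates

section Flow

variable {σ : ℤˣ} {s : Fin 3} {q w : ℝ²} {γ : ℝ → LSurface} {t τ : ℝ}

/-- From time `t` on, `γ` moves for a while along a straight line with local velocity `w`, starting
at the local coordinates `q` in the square `s`. -/
def Leaves (γ : ℝ → LSurface) (σ : ℤˣ) (w : ℝ²) (t : ℝ) (s : Fin 3) (q : ℝ²) : Prop :=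
  ∃ δ > 0, ∀ u ∈ Icc 0 δ, HasCoords (γ (t + u)) σ s (q + u • w)

lemma Leaves.hasCoords (L : Leaves γ σ w t s q) : HasCoords (γ t) σ s q := by
  obtain ⟨δ, hδ, H⟩ := L
  simpa only [add_zero, zero_smul] using H 0 ⟨le_rfl, hδ.le⟩

namespace IsHalfGeodesic

lemma exists_leaves (G : IsHalfGeodesic (σ • w) γ) (hw : ∀ i, 0 < w i) (ht : 0 ≤ t) :
    ∃ s q, (∀ i, q i ∈ Ico (0 : ℝ) 1) ∧ Leaves γ σ w t s q := by
  obtain ⟨p, ε, hε, H⟩ := G.leaves t ht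
  obtain ⟨hp, -⟩ := H 0 ⟨le_rfl, hε.le⟩
  obtain ⟨hpε, -⟩ := H ε ⟨hε.le, le_rfl⟩
  rw [zero_smul, add_zero] at hp
  rw [smul_comm] at hpε
  obtain ⟨s, q, hq, rfl⟩ := exists_eq_chart_Ico (fun i => mul_pos hε (hw i)) hp hpε
  refine ⟨s, q, hq, ε, hε, fun u hu => ?_⟩
  obtain ⟨hpu, hγ⟩ := H u hu
  exact ⟨_, chart_add_smul σ s q w u, hγ.symm⟩

lemma leaves_of_hasCoords (G : IsHalfGeodesic (σ • w) γ) (hw : ∀ i, 0 < w i) (ht : 0 < t)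
    (hq : ∀ i, q i ∈ Ico (0 : ℝ) 1) (hγ : HasCoords (γ t) σ s q) : Leaves γ σ w t s q := by
  obtain ⟨s', q', hq', L⟩ := G.exists_leaves hw ht.le
  obtain ⟨rfl, rfl⟩ := L.hasCoords.unique hγ hq' hq (G.avoids_vertices t ht)
  exact L

lemma hasCoords_of_arrives (G : IsHalfGeodesic (σ • w) γ) (ht : 0 < t) {δ : ℝ} (hδ : 0 < δ)
    (H : ∀ u ∈ Ioc 0 δ, (∀ i, (q - u • w) i ∈ Ioo (0 : ℝ) 1) ∧
      HasCoords (γ (t - u)) σ s (q - u • w)) :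
    HasCoords (γ t) σ s q := by
  obtain ⟨p, ε, hε, arrives⟩ := G.arrives t ht
  have hm : 0 < min δ ε := lt_min hδ hε
  obtain ⟨interior, p', hp', hγ'⟩ := H (min δ ε) ⟨hm, min_le_left _ _⟩
  obtain ⟨hmem, hγ⟩ := arrives (min δ ε) ⟨hm.le, min_le_right _ _⟩
  have rep_eq : p - min δ ε • σ • w = p'.1 := eq_of_mk_eq_of_not_isGrid (hγ.symm.trans hγ'.symm)
    fun i => hp' ▸ not_isGrid_chart (interior i)
  have p_eq : p = chart σ s q := by
    rw [← sub_add_cancel p (min δ ε • σ • w), rep_eq, hp', chart_add_smul, sub_add_cancel]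
  obtain ⟨hmem₀, hγ₀⟩ := arrives 0 ⟨le_rfl, hε.le⟩
  rw [sub_zero] at hγ₀
  refine ⟨_, ?_, hγ₀.symm⟩
  change p - (0 : ℝ) • σ • w = _
  rw [zero_smul, sub_zero, p_eq]

lemma hasCoords_of_leaves (G : IsHalfGeodesic (σ • w) γ) (hw : ∀ i, 0 < w i) (ht : 0 ≤ t)
    (hq : ∀ i, q i ∈ Ico (0 : ℝ) 1) (L : Leaves γ σ w t s q) (hτ : ∀ i, q i + τ * w i ≤ 1) :
    ∀ u ∈ Icc 0 τ, HasCoords (γ (t + u)) σ s (q + u • w) := by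
  have coord_nonneg : ∀ {u : ℝ} (i), 0 ≤ u → 0 ≤ (q + u • w) i := fun i hu =>
    add_nonneg (hq i).1 (mul_nonneg hu (hw i).le)
  have coord_pos : ∀ {u : ℝ} (i), 0 < u → 0 < (q + u • w) i := fun i hu =>
    add_pos_of_nonneg_of_pos (hq i).1 (mul_pos hu (hw i))
  have coord_lt : ∀ {u : ℝ} (i), u < τ → (q + u • w) i < 1 := fun i hu =>
    (add_lt_add_right (mul_lt_mul_of_pos_right hu (hw i)) _).trans_le (hτ i)
  refine forall_mem_Icc_of_left_of_right (fun x hx before => ?_) (fun x hx hγ => ?_)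
  · rcases hx.1.eq_or_lt with rfl | hpos
    · simpa only [add_zero, zero_smul] using L.hasCoords
    · refine G.hasCoords_of_arrives (by linarith) (half_pos hpos) fun u hu => ?_
      have hxu : 0 < x - u := by linarith [hu.2]
      have hxτ : x - u < τ := by linarith [hu.1, hx.2]
      rw [add_sub_assoc, add_sub_assoc, ← sub_smul]
      exact ⟨fun i => ⟨coord_pos i hxu, coord_lt i hxτ⟩, before _ ⟨hxu.le, by linarith [hu.1]⟩⟩
  · have leaves : Leaves γ σ w (t + x) s (q + x • w) := by
      rcases hx.1.eq_or_lt with rfl | hpos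
      · simpa only [add_zero, zero_smul] using L
      · exact G.leaves_of_hasCoords hw (by linarith)
          (fun i => ⟨coord_nonneg i hpos.le, coord_lt i hx.2⟩) hγ
    obtain ⟨δ, hδ, H⟩ := leaves
    refine ⟨x + δ, by linarith, fun y hy => ?_⟩
    have := H (y - x) ⟨by linarith [hy.1], by linarith [hy.2]⟩
    rwa [add_add_sub_cancel, add_assoc, ← add_smul, add_sub_cancel] at this

lemma inStrip_of_leaves (G : IsHalfGeodesic (σ • w) γ) (hw : ∀ i, 0 < w i) (hw' : w 0 ≤ w 1)
    (ht : 0 ≤ t) (hq : ∀ i, q i ∈ Ico (0 : ℝ) 1) (L : Leaves γ σ w t s q) (hτ : 0 ≤ τ)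
    (h₁ : q 1 + τ * w 1 ≤ 1) : InStrip (γ (t + τ)) σ s (q + τ • w) := by
  obtain ⟨hq₀, hq₀'⟩ := hq 0
  obtain ⟨hq₁, -⟩ := hq 1
  have hw₀ := hw 0
  have hw₁ := hw 1
  have hτw : τ * w 0 ≤ τ * w 1 := mul_le_mul_of_nonneg_left hw' hτ
  have hτw₀ : 0 ≤ τ * w 0 := mul_nonneg hτ hw₀.le
  rcases le_or_gt (q 0 + τ * w 0) 1 with h₀ | h₀
  · exact Or.inl ⟨⟨add_nonneg hq₀ hτw₀, h₀⟩,
      G.hasCoords_of_leaves hw ht hq L (Fin.forall_fin_two.2 ⟨h₀, h₁⟩) τ ⟨hτ, le_rfl⟩⟩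
  · obtain ⟨u, hu⟩ : ∃ u, q 0 + u * w 0 = 1 := ⟨(1 - q 0) / w 0, by field_simp; ring⟩
    have hu₀ : 0 < u := by nlinarith
    have huτ : u < τ := by nlinarith
    have hu₁ : q 1 + u * w 1 < 1 := by nlinarith
    have hu₁' : 0 ≤ q 1 + u * w 1 := by positivity
    set r := q + u • w - !₂[1, 0]
    have hr : ∀ i, r i ∈ Ico (0 : ℝ) 1 := Fin.forall_fin_two.2
      ⟨by simp [r, hu], by simpa [r] using ⟨hu₁', hu₁⟩⟩
    have at_edge : HasCoords (γ (t + u)) σ (right s) r :=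
      (G.hasCoords_of_leaves hw ht hq L (Fin.forall_fin_two.2 ⟨hu.le, hu₁.le⟩) u
        ⟨hu₀.le, le_rfl⟩).right hu ⟨hu₁', hu₁.le⟩
    have after_edge := G.hasCoords_of_leaves hw (by positivity) hr
      (G.leaves_of_hasCoords hw (by positivity) hr at_edge) (τ := τ - u)
      (Fin.forall_fin_two.2 ⟨by simp [r]; linarith, by simp [r]; linarith⟩)
      (τ - u) ⟨by linarith, le_rfl⟩
    refine Or.inr ⟨⟨h₀.le, by change q 0 + τ * w 0 ≤ 2; linarith⟩, ?_⟩
    have coords : q + τ • w - !₂[1, 0] = r + (τ - u) • w := by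
      simp only [r, sub_smul]
      abel
    rw [coords]
    rwa [add_add_sub_cancel] at after_edge

lemma exists_skewStep (G : IsHalfGeodesic (σ • w) γ) (hw : ∀ i, 0 < w i) (hw' : w 0 ≤ w 1)
    (ht : 0 ≤ t) (hq : ∀ i, q i ∈ Ico (0 : ℝ) 1) (L : Leaves γ σ w t s q) (hτ : 0 < τ)
    (h₁ : q 1 + τ * w 1 = 1) :
    ∃ p : ℝ × Fin 3, p.1 ∈ Ioo (0 : ℝ) 1 ∧ HasCoords (γ (t + τ)) σ p.2 !₂[p.1, 0] ∧
      SkewStep (τ * w 0) right up (q 0, s) p := by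
  have hv : ¬ (γ (t + τ)).IsVertex := G.avoids_vertices _ (by positivity)
  have mem_Ioo : ∀ {x s'}, HasCoords (γ (t + τ)) σ s' !₂[x, 0] → x ∈ Icc (0 : ℝ) 1 →
      x ∈ Ioo (0 : ℝ) 1 := fun h hx => by
    exact ⟨hx.1.lt_of_ne' fun h₀ => hv (h.isVertex (Fin.forall_fin_two.2 ⟨Or.inl h₀, Or.inl rfl⟩)),
      hx.2.lt_of_ne fun h₀ => hv (h.isVertex (Fin.forall_fin_two.2 ⟨Or.inr h₀, Or.inl rfl⟩))⟩
  rcases G.inStrip_of_leaves hw hw' ht hq L hτ.le h₁.le with ⟨hx, h⟩ | ⟨hx, h⟩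
  · have coords : q + τ • w - !₂[0, 1] = !₂[q 0 + τ * w 0, 0] :=
      PiLp.ext (Fin.forall_fin_two.2 ⟨by simp, by simp [h₁]⟩)
    have above := h.up hx h₁
    rw [coords] at above
    exact ⟨(_, _), mem_Ioo above hx, above, Or.inl rfl⟩
  · have coords : q + τ • w - !₂[1, 0] - !₂[0, 1] = !₂[q 0 + τ * w 0 - 1, 0] :=
      PiLp.ext (Fin.forall_fin_two.2 ⟨by simp, by simp [h₁]⟩)
    have hx' := sub_mem_unit hx ⟨zero_le_one.trans h₁.ge, h₁.le⟩ 0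
    have above := h.up hx' (by simp [h₁])
    rw [coords] at above
    exact ⟨(_, _), mem_Ioo above (by simpa using hx'), above, Or.inr rfl⟩

lemma exists_isSkewOrbit (G : IsHalfGeodesic (σ • w) γ) (hw : ∀ i, 0 < w i) (hw' : w 0 ≤ w 1) :
    ∃ t₀, 0 < t₀ ∧ t₀ ≤ 1 / w 1 ∧ ∃ o, IsSkewOrbit (w 0 / w 1) right up o ∧
      ∀ m : ℕ, HasCoords (γ (t₀ + m / w 1)) σ (o m).2 !₂[(o m).1, 0] := by
  have hw₁ := hw 1
  obtain ⟨s, q, hq, L⟩ := G.exists_leaves hw le_rfl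
  obtain ⟨hq₁, hq₁'⟩ := hq 1
  have ht₀ : 0 < (1 - q 1) / w 1 := div_pos (sub_pos.2 hq₁') hw₁
  obtain ⟨o, ho⟩ := exists_seq_of_forall_exists_succ
    (P := fun (m : ℕ) (p : ℝ × Fin 3) => p.1 ∈ Ioo (0 : ℝ) 1 ∧
      HasCoords (γ ((1 - q 1) / w 1 + m / w 1)) σ p.2 !₂[p.1, 0])
    (R := SkewStep (w 0 / w 1) right up)
    (by
      obtain ⟨p, hp, hγ, -⟩ := G.exists_skewStep hw hw' le_rfl hq L ht₀ (by field_simp; ring)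
      exact ⟨p, hp, by simpa using hγ⟩)
    (fun m p ⟨hp, hγ⟩ => by
      have ht : 0 < (1 - q 1) / w 1 + m / w 1 := by positivity
      have hp' : ∀ i, (!₂[p.1, 0] : ℝ²) i ∈ Ico (0 : ℝ) 1 :=
        Fin.forall_fin_two.2 ⟨Ioo_subset_Ico_self hp, left_mem_Ico.2 one_pos⟩
      obtain ⟨p', hp', hγ', hstep⟩ := G.exists_skewStep hw hw' ht.le hp'
        (G.leaves_of_hasCoords hw ht hp' hγ) (τ := 1 / w 1) (by positivity) (by simp [hw₁.ne'])
      rw [one_div_mul_eq_div] at hstep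
      refine ⟨p', ⟨hp', ?_⟩, hstep⟩
      rwa [add_assoc, ← add_div, ← Nat.cast_succ] at hγ')
  exact ⟨_, ht₀, by gcongr; linarith, o, ⟨fun m => (ho m).1.1, fun m => (ho m).2⟩,
    fun m => (ho m).1.2⟩

lemma exists_isPath_le (G : IsHalfGeodesic (σ • w) γ) (hw : ∀ i, 0 < w i) (hw' : w 0 ≤ w 1)
    {ε N : ℝ} (H : ∀ y ∈ Icc (0 : ℝ) 1, HitsWithin (w 0 / w 1) right up (closedBall y ε) N)
    (P : LSurface) : ∃ t ∈ Icc 0 ((N + 2) / w 1), ∃ ℓ ≤ ε, IsPath (γ t) P ℓ := by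
  have hw₀ := hw 0
  have hw₁ := hw 1
  obtain ⟨s, y, hy, b, hb, hP⟩ :=
    exists_inStrip σ P (θ := w 0 / w 1) ⟨by positivity, (div_le_one hw₁).2 hw'⟩
  obtain ⟨t₀, ht₀, ht₀', o, ho, hγ⟩ := G.exists_isSkewOrbit hw hw'
  obtain ⟨m, hm, rfl, hball⟩ := H y hy o ho s
  have ht : 0 < t₀ + m / w 1 := by positivity
  have hq : ∀ i, (!₂[(o m).1, 0] : ℝ²) i ∈ Ico (0 : ℝ) 1 :=
    Fin.forall_fin_two.2 ⟨Ioo_subset_Ico_self (ho.mem_Ioo m), left_mem_Ico.2 one_pos⟩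
  have hb₀ : 0 ≤ b / w 1 := div_nonneg hb.1 hw₁.le
  have strip := G.inStrip_of_leaves hw hw' ht.le hq (G.leaves_of_hasCoords hw ht hq (hγ m)) hb₀
    (by simp [hw₁.ne', hb.2])
  have height_eq : (!₂[(o m).1, 0] + (b / w 1) • w : ℝ²) 1 = b := by simp [hw₁.ne']
  have path := strip.isPath hP height_eq (by rwa [height_eq])
  refine ⟨_, ⟨by positivity, ?_⟩, _, ?_, path⟩
  · calc t₀ + m / w 1 + b / w 1 ≤ 1 / w 1 + N / w 1 + 1 / w 1 := by gcongr; exact hb.2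
      _ = (N + 2) / w 1 := by ring
  · rw [mem_closedBall, Real.dist_eq] at hball
    convert hball using 2
    simp
    ring

lemma isSuperdenseWith (G : IsHalfGeodesic (σ • w) γ) (hw : ∀ i, 0 < w i) (hw' : w 0 ≤ w 1)
    (hw₁ : 1 / 2 ≤ w 1) {C : ℝ} (H : ∀ K : ℝ, 1 ≤ K → ∀ y ∈ Icc (0 : ℝ) 1,
      HitsWithin (w 0 / w 1) right up (closedBall y (1 / K)) (C * K)) :
    IsSuperdenseWith (4 * C + 4) γ := by
  intro n hn P
  have hn' : (1 : ℝ) ≤ n := by exact_mod_cast hn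
  obtain ⟨t, ht, ℓ, hℓ, path⟩ :=
    G.exists_isPath_le hw hw' (H (2 * n) (by linarith)) P
  refine ⟨t, ⟨ht.1, ht.2.trans ?_⟩, (iInf₂_le ℓ path).trans_lt ?_⟩
  · have hN : 0 ≤ C * (2 * n) + 2 := by
      by_contra! hneg
      exact (ht.1.trans ht.2).not_gt (div_neg_of_neg_of_pos hneg (hw 1))
    calc (C * (2 * n) + 2) / w 1 ≤ (C * (2 * n) + 2) / (1 / 2) := by gcongr
      _ ≤ (4 * C + 4) * n := by linarith
  · exact (ENNReal.ofReal_lt_ofReal_iff (by positivity)).2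
      (hℓ.trans_lt (one_div_lt_one_div_of_lt (by linarith) (by linarith)))

end IsHalfGeodesic

end Flow

lemma exists_eq_units_smul {α : ℝ} (hα : 1 < α) {v : ℝ²} (hv : ‖v‖ = 1) (hslope : v 1 = α * v 0) :
    ∃ (σ : ℤˣ) (w : ℝ²), v = σ • w ∧ (∀ i, 0 < w i) ∧ w 0 ≤ w 1 ∧ 1 / 2 ≤ w 1 ∧
      w 0 / w 1 = α⁻¹ := by
  have norm_sq : v 0 ^ 2 + v 1 ^ 2 = 1 := by
    rw [← Fin.sum_univ_two (f := fun i => v i ^ 2), ← EuclideanSpace.real_norm_sq_eq, hv, one_pow]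
  have v_zero_ne : v 0 ≠ 0 := fun h => by simp [hslope, h] at norm_sq
  obtain ⟨σ, hσ⟩ : ∃ σ : ℤˣ, 0 < (σ • v) 0 := by
    rcases v_zero_ne.lt_or_gt with h | h
    · exact ⟨-1, by simpa using h⟩
    · exact ⟨1, by simpa using h⟩
  have slope : (σ • v) 1 = α * (σ • v) 0 := by
    simp only [Units.smul_def, PiLp.smul_apply, hslope, mul_smul_comm]
  have norm_sq' : (σ • v) 0 ^ 2 + (σ • v) 1 ^ 2 = 1 := by
    rcases Int.units_eq_one_or σ with rfl | rfl <;> simpa using norm_sq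
  have le : (σ • v) 0 ≤ (σ • v) 1 := by nlinarith
  refine ⟨σ, σ • v, ?_, Fin.forall_fin_two.2 ⟨hσ, hσ.trans_le le⟩, le, by nlinarith, ?_⟩
  · rw [smul_smul, Int.units_mul_self, one_smul]
  · rw [slope]
    field_simp

end LSurface

end

theorem theorem6p1p1 (α : ℝ) (hα : 1 < α) (hbad : IsBadlyApproximable α)
    (a : ℕ → ℕ) (ha : HasContFracDigits α a) (hdigits : ∀ i, 0 < a i ∧ Even (a i)) :
    ∃ C : ℝ, 0 < C ∧
      ∀ v : EuclideanSpace ℝ (Fin 2), ‖v‖ = 1 → v 1 = α * v 0 →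
        ∀ γ : ℝ → LSurface, LSurface.IsHalfGeodesic v γ → LSurface.IsSuperdenseWith C γ := by
  obtain ⟨D, hD⟩ := hbad.exists_inv_gaussIterate_le ha
  obtain ⟨C, hC, hits⟩ := exists_hitsWithin_closedBall (ha.isEvenGaussStep hdigits) hD
    LSurface.isTranspositionPair_right_up
  refine ⟨4 * C + 4, by positivity, fun v hv hslope γ G => ?_⟩
  obtain ⟨σ, w, rfl, hw, hw', hw₁, hθ⟩ := LSurface.exists_eq_units_smul hα hv hslope
  exact G.isSuperdenseWith hw hw' hw₁ (hθ ▸ hits)
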